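/- Let $K$ be any field, let $n\ge 0$ and $c\ge 1$ be integers, and let $R=K[x_0,\dots,x_n]$ with its standard grading. Let $F_1,\dots,F_{n+c}\in R$ be forms (homogeneous polynomials) of degrees $d_1,\dots,d_{n+c}\ge 0$, where the zero polynomial is allowed as a form of any degree, and let $I=(F_1,\dots,F_{n+c})$. Let $H_{R/I}(T)=\sum_{D\ge 0}\dim_K\big((R/I)_D\big)\,T^D\in\mathbb{Z}[[T]]$ be the Hilbert series of $R/I$, where $(R/I)_D$ is the image in $R/I$ of the space of homogeneous polynomials of degree $D$. Then $$H_{R/I}(T)\;\ge\;\Big(1-\sum_{j=n+2}^{n+c}T^{d_j}\Big)\frac{\prod_{j=1}^{n+1}(1-T^{d_j})}{(1-T)^{n+1}}$$ coefficient-wise in $\mathbb{Z}[[T]]$, that is, for every $D\ge 0$ the coefficient of $T^D$ on the left is at least the one on the right. If moreover $d_1=\dots=d_{n+c}=d$, then the right-hand side equals $(1-(c-1)T^d)(1+T+\dots+T^{d-1})^{n+1}$ (where $1+T+\dots+T^{d-1}$ is $0$ for $d=0$), and consequently $$H_{R/I}(T)\;\ge\;(1-(c-1)T^d)\,(1+T+\dots+T^{d-1})^{n+1}$$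 coefficient-wise. -/

import Mathlib

noncomputable section

/-- The Hilbert function of a module graded by the subspaces `𝓜 0, 𝓜 1, 𝓜 2, …`:
its value at `i` is the `K`-dimension of the graded piece `𝓜 i`. -/
def hilbertFunction (K : Type*) {M : Type*} [Field K] [AddCommGroup M] [Module K M]
    (𝓜 : ℕ → Submodule K M) (i : ℕ) : ℕ :=
  Module.finrank K (𝓜 i)

/-- The Hilbert series `∑ i, dim (𝓜 i) T ^ i`, as a power series with integer coefficients. -/
def hilbertSeries (K : Type*) {M : Type*} [Field K] [AddCommGroup M] [Module K M]
    (𝓜 : ℕ → Submodule K M) : PowerSeries ℤ :=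
  PowerSeries.mk fun i => (hilbertFunction K 𝓜 i : ℤ)

/-- The degree `i` graded piece of `K[x_σ] ⧸ I` (for `I` an ideal generated by forms): the classes
of the homogeneous polynomials of degree `i`. -/
def quotientPiece {K σ : Type*} [Field K] (I : Ideal (MvPolynomial σ K)) (i : ℕ) :
    Submodule K (MvPolynomial σ K ⧸ I) :=
  (MvPolynomial.homogeneousSubmodule σ K i).map (Ideal.Quotient.mkₐ K I).toLinearMap

/-- The graded pieces are finite dimensional, so that `Module.finrank` is their true dimension. -/
instance quotientPiece_finite {K σ : Type*} [Field K] [Finite σ]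
    (I : Ideal (MvPolynomial σ K)) (i : ℕ) : Module.Finite K (quotientPiece I i) :=
  Module.Finite.iff_fg.mpr ((MvPolynomial.homogeneousSubmodule_fg σ K i).map _)

end

section LinearIndependence

open Polynomial

/-- Vectors over `K[X]` which are linearly independent at one point are linearly independent. -/
theorem linearIndependent_of_eval {K M M' ι : Type*} [Field K] [AddCommGroup M] [Module K M]
    [AddCommGroup M'] [Module K[X] M'] [Module.IsTorsionFree K[X] M'] (a : K)
    (f : M' →ₛₗ[Polynomial.evalRingHom a] M) (v : ι → M') (h : LinearIndependent K (f ∘ v)) :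
    LinearIndependent K[X] v := by
  rw [linearIndependent_iff'] at h ⊢
  intro s
  have key : ∀ (N : ℕ) (c : ι → K[X]), (∑ i ∈ s, c i • v i = 0) →
      (∑ i ∈ s, (c i).natDegree ≤ N) → ∀ i ∈ s, c i = 0 := by
    intro N
    induction N using Nat.strong_induction_on with
    | _ N ih =>
      intro c hc hN
      have h0 : ∀ i ∈ s, (c i).eval a = 0 := by
        apply h s (fun i => (c i).eval a)
        have := congrArg f hc
        simpa [map_sum] using this
      choose! q hq using fun i hi => dvd_iff_isRoot.mpr (h0 i hi)
      have hq0 : ∑ i ∈ s, q i • v i = 0 := by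
        have h1 : (X - C a) • ∑ i ∈ s, q i • v i = 0 := by
          rw [← hc, Finset.smul_sum]
          exact Finset.sum_congr rfl fun i hi => by rw [smul_smul, ← hq i hi]
        exact (smul_eq_zero.mp h1).resolve_left (X_sub_C_ne_zero a)
      by_contra! hne
      obtain ⟨i, hi, hci⟩ := hne
      have hqi : q i ≠ 0 := fun h => hci (by rw [hq i hi, h, mul_zero])
      have hle : ∀ j ∈ s, (q j).natDegree ≤ (c j).natDegree := by
        intro j hj
        by_cases hqj : q j = 0
        · simp [hqj]
        · rw [hq j hj, natDegree_mul (X_sub_C_ne_zero a) hqj]; omega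
      have hlt : ∑ j ∈ s, (q j).natDegree < ∑ j ∈ s, (c j).natDegree := by
        refine Finset.sum_lt_sum hle ⟨i, hi, ?_⟩
        rw [hq i hi, natDegree_mul (X_sub_C_ne_zero a) hqi, natDegree_X_sub_C]; omega
      exact hqi (ih _ (lt_of_lt_of_le hlt hN) q hq0 le_rfl i hi)
  exact fun c hc i hi => key _ c hc le_rfl i hi

/-- Multivariate polynomials with coefficients in `K[X]` which are linearly independent at one
point are linearly independent over the fraction field of `K[X]`. -/
theorem linearIndependent_map_fractionRing {K σ ι : Type*} [Field K] (a : K)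
    (v : ι → MvPolynomial σ K[X])
    (h : LinearIndependent K fun i => MvPolynomial.map (evalRingHom a) (v i)) :
    LinearIndependent (FractionRing K[X])
      fun i => MvPolynomial.map (algebraMap K[X] (FractionRing K[X])) (v i) := by
  rw [← LinearIndependent.iff_fractionRing K[X] (FractionRing K[X])]
  let f : MvPolynomial σ K[X] →ₛₗ[evalRingHom a] MvPolynomial σ K :=
    { (MvPolynomial.map (evalRingHom a) : MvPolynomial σ K[X] →+* MvPolynomial σ K) with
      map_smul' := fun r x => by simp [MvPolynomial.smul_eq_C_mul] }
  have h1 : LinearIndependent K[X] v := linearIndependent_of_eval a f v h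
  let g : MvPolynomial σ K[X] →ₗ[K[X]] MvPolynomial σ (FractionRing K[X]) :=
    { (MvPolynomial.map (algebraMap K[X] (FractionRing K[X])) :
        MvPolynomial σ K[X] →+* MvPolynomial σ (FractionRing K[X])) with
      map_smul' := fun r x => by simp [Algebra.smul_def, MvPolynomial.algebraMap_eq] }
  exact h1.map' g (LinearMap.ker_eq_bot.mpr
    (MvPolynomial.map_injective _ (IsFractionRing.injective K[X] (FractionRing K[X]))))

end LinearIndependence

section Box

open PowerSeries

/-- The exponents of total degree `D` whose `i`-th entry is less than `e i` for all `i < p`. -/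
def boxExponents {k : ℕ} (e : Fin k → ℕ) (p D : ℕ) : Finset (Fin k →₀ ℕ) :=
  {m ∈ Finset.finsuppAntidiag Finset.univ D | ∀ i : Fin k, i.val < p → m i < e i}

theorem mem_boxExponents {k : ℕ} {e : Fin k → ℕ} {p D : ℕ} {m : Fin k →₀ ℕ} :
    m ∈ boxExponents e p D ↔ m.degree = D ∧ ∀ i : Fin k, i.val < p → m i < e i := by
  simp [boxExponents, Finset.mem_finsuppAntidiag, Finsupp.degree_eq_sum]

theorem boxExponents_of_le {k : ℕ} (e : Fin k → ℕ) {p : ℕ} (hp : k ≤ p) (D : ℕ) :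
    boxExponents e p D = boxExponents e k D := by
  ext m
  simp only [mem_boxExponents]
  exact and_congr_right fun _ => ⟨fun h i _ => h i (by omega), fun h i _ => h i i.2⟩

/-- The generating function counting the exponents in `boxExponents e p`. -/
noncomputable def boxSeries {k : ℕ} (e : Fin k → ℕ) (p : ℕ) : PowerSeries ℤ :=
  PowerSeries.mk fun D => ((boxExponents e p D).card : ℤ)

theorem coeff_X_pow_mul_boxSeries {k : ℕ} (e : Fin k → ℕ) (p a D : ℕ) :
    coeff D (X ^ a * boxSeries e p) =
      ((if a ≤ D then boxExponents e p (D - a) else ∅).card : ℤ) := by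
  rw [coeff_X_pow_mul']
  split_ifs <;> simp [boxSeries]

theorem boxSeries_zero {k : ℕ} (e : Fin (k + 1) → ℕ) :
    boxSeries e 0 = (invOneSubPow ℤ (k + 1) : PowerSeries ℤ) := by
  ext D
  rw [invOneSubPow_val_succ_eq_mk_add_choose]
  simp only [boxSeries, coeff_mk, boxExponents, not_lt_zero, IsEmpty.forall_iff, implies_true,
    Finset.filter_true]
  rw [Finset.card_finsuppAntidiag_nat_eq_choose, Finset.card_univ, Fintype.card_fin,
    show k + 1 + D - 1 = k + D by omega, Nat.choose_symm_add]

theorem boxSeries_succ {k : ℕ} (e : Fin k → ℕ) (i : Fin k) :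
    boxSeries e (i + 1) = (1 - X ^ e i) * boxSeries e i := by
  rw [sub_mul, one_mul, eq_sub_iff_add_eq]
  ext D
  rw [map_add, coeff_X_pow_mul_boxSeries]
  simp only [boxSeries, coeff_mk]
  rw [← Nat.cast_add]
  congr 1
  rw [← Finset.card_filter_add_card_filter_not (s := boxExponents e i D) (fun m => m i < e i)]
  congr 1
  · congr 1
    ext m
    simp only [mem_boxExponents, Finset.mem_filter, and_assoc]
    refine and_congr_right fun _ => ⟨fun h => ⟨fun j hj => h j (by omega), h i (by omega)⟩, ?_⟩
    rintro ⟨h1, h2⟩ j hj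
    rcases Nat.lt_succ_iff_lt_or_eq.mp hj with h | h
    · exact h1 j h
    · rwa [Fin.ext h]
  · refine Finset.card_bij (fun m _ => m + Finsupp.single i (e i)) ?_ ?_ ?_
    · intro m hm
      split_ifs at hm with hD
      · rw [mem_boxExponents] at hm
        rw [Finset.mem_filter, mem_boxExponents]
        refine ⟨⟨by rw [map_add, hm.1, Finsupp.degree_single]; omega, fun j hj => ?_⟩, by simp⟩
        have : i ≠ j := fun h => by simp [h] at hj
        simpa [Finsupp.single_apply, this] using hm.2 j hj
      · simp at hm
    · intro m _ m' _ h
      exact add_right_cancel h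
    · intro m hm
      rw [Finset.mem_filter, mem_boxExponents] at hm
      obtain ⟨⟨h1, h2⟩, h3⟩ := hm
      have hle : Finsupp.single i (e i) ≤ m := by
        rw [Finsupp.single_le_iff]; exact not_lt.mp h3
      have hm : m - Finsupp.single i (e i) + Finsupp.single i (e i) = m := tsub_add_cancel_of_le hle
      refine ⟨m - Finsupp.single i (e i), ?_, hm⟩
      have hdeg : (m - Finsupp.single i (e i)).degree + e i = D := by
        rw [← h1]; conv_rhs => rw [← hm]
        simp
      rw [if_pos (by omega), mem_boxExponents]
      refine ⟨by omega, fun j hj => lt_of_le_of_lt ?_ (h2 j hj)⟩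
      exact (tsub_le_self : m - Finsupp.single i (e i) ≤ m) j

theorem boxSeries_eq {k : ℕ} (e : Fin (k + 1) → ℕ) :
    boxSeries e (k + 1) = (∏ i, (1 - X ^ e i)) * (invOneSubPow ℤ (k + 1) : PowerSeries ℤ) := by
  have key : ∀ p ≤ k + 1, boxSeries e p =
      (∏ i : Fin (k + 1) with i.val < p, (1 - X ^ e i)) *
        (invOneSubPow ℤ (k + 1) : PowerSeries ℤ) := by
    intro p
    induction p with
    | zero => intro _; simp [boxSeries_zero]
    | succ p ih =>
      intro hp
      have h := boxSeries_succ e ⟨p, hp⟩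
      rw [ih (by omega)] at h
      have hf : Finset.univ.filter (fun i : Fin (k + 1) => i.val < p + 1) =
          insert ⟨p, hp⟩ (Finset.univ.filter fun i : Fin (k + 1) => i.val < p) := by
        ext j
        simp [Fin.ext_iff]
        omega
      rw [h, hf, Finset.prod_insert (by simp), mul_assoc]
  rw [key _ le_rfl, Finset.filter_true_of_mem fun i _ => i.2]

theorem sum_X_pow_mul_boxSeries {k : ℕ} (e : Fin k → ℕ) :
    ∑ i : Fin k, X ^ e i * boxSeries e i = boxSeries e 0 - boxSeries e k := by
  have h : ∀ i : Fin k, X ^ e i * boxSeries e i = boxSeries e i - boxSeries e (i + 1) := fun i => by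
    rw [boxSeries_succ]; ring
  rw [Finset.sum_congr rfl fun i _ => h i,
    Fin.sum_univ_eq_sum_range (fun i => boxSeries e i - boxSeries e (i + 1)),
    Finset.sum_range_sub']

end Box

section Forms

open MvPolynomial

variable {K : Type*} [Field K] {k N : ℕ}

theorem MvPolynomial.IsHomogeneous.mem_span_monomial {f : MvPolynomial (Fin k) K} {D : ℕ}
    (hf : f.IsHomogeneous D) :
    f ∈ Submodule.span K {g | ∃ m : Fin k →₀ ℕ, m.degree = D ∧ g = monomial m 1} := by
  rw [f.as_sum]
  refine Submodule.sum_mem _ fun m hm => ?_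
  rw [← mul_one (coeff m f), ← smul_eq_mul, ← smul_monomial]
  refine Submodule.smul_mem _ _ (Submodule.subset_span ⟨m, ?_, rfl⟩)
  rw [Finsupp.degree_eq_weight_one]
  exact hf (mem_support_iff.mp hm)

/-- The span of the products of degree `D` of one of the forms `G j`, `j < p`, of degree `d j`
with a monomial. -/
noncomputable def productSpan (G : Fin N → MvPolynomial (Fin k) K) (d : Fin N → ℕ) (p D : ℕ) :
    Submodule K (MvPolynomial (Fin k) K) :=
  Submodule.span K {f | ∃ (j : Fin N) (m : Fin k →₀ ℕ),
    j.val < p ∧ m.degree + d j = D ∧ f = G j * monomial m 1}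

variable {G : Fin N → MvPolynomial (Fin k) K} {d : Fin N → ℕ}

theorem mul_mem_productSpan {p a D : ℕ} {j : Fin N} (hj : j.val < p)
    {f : MvPolynomial (Fin k) K} (hf : f.IsHomogeneous a) (hD : a + d j = D) :
    G j * f ∈ productSpan G d p D := by
  have h := Submodule.mem_map_of_mem (f := LinearMap.mulLeft K (G j)) hf.mem_span_monomial
  rw [Submodule.map_span] at h
  refine Submodule.span_mono ?_ h
  rintro _ ⟨_, ⟨m, hm, rfl⟩, rfl⟩
  exact ⟨j, m, hj, by rw [hm, hD], rfl⟩

theorem form_mul_mem_productSpan (hG : ∀ j, (G j).IsHomogeneous (d j)) {p a D : ℕ} {j : Fin N}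
    {f : MvPolynomial (Fin k) K} (hf : f ∈ productSpan G d p a) (hD : a + d j = D) :
    G j * f ∈ productSpan G d p D := by
  induction hf using Submodule.span_induction with
  | mem f hf =>
    obtain ⟨i, m, hi, hm, rfl⟩ := hf
    rw [mul_left_comm]
    exact mul_mem_productSpan hi ((hG j).mul (isHomogeneous_monomial 1 rfl)) (by omega)
  | zero => simp
  | add f g _ _ hf hg => rw [mul_add]; exact add_mem hf hg
  | smul c f _ hf => rw [mul_smul_comm]; exact Submodule.smul_mem _ _ hf

theorem homogeneousComponent_mul_mem_productSpan (hG : ∀ j, (G j).IsHomogeneous (d j)) (j : Fin N)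
    (f : MvPolynomial (Fin k) K) (D : ℕ) :
    homogeneousComponent D (G j * f) ∈ productSpan G d N D := by
  rw [f.as_sum, Finset.mul_sum, map_sum]
  refine Submodule.sum_mem _ fun m _ => ?_
  have hm : (monomial m (coeff m f)).IsHomogeneous m.degree := isHomogeneous_monomial _ rfl
  rw [homogeneousComponent_of_mem ((hG j).mul hm)]
  split_ifs with h
  · exact mul_mem_productSpan j.2 hm (by omega)
  · exact zero_mem _

theorem mem_productSpan_of_mem_span (hG : ∀ j, (G j).IsHomogeneous (d j))
    {f : MvPolynomial (Fin k) K} {D : ℕ} (hf : f.IsHomogeneous D)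
    (hfI : f ∈ Ideal.span (Set.range G)) : f ∈ productSpan G d N D := by
  obtain ⟨c, rfl⟩ := Ideal.mem_span_range_iff_exists_fun.mp hfI
  rw [← homogeneousComponent_eq_self hf, map_sum]
  refine Submodule.sum_mem _ fun j _ => ?_
  rw [mul_comm]
  exact homogeneousComponent_mul_mem_productSpan hG j _ D

/-- If the monomials in a set `B p D`, together with the forms `G j`, `j < p`, span the polynomials
of degree `D`, then multiples of `G j` by monomials in `B j` suffice to span the ideal. -/
theorem productSpan_le_span (hG : ∀ j, (G j).IsHomogeneous (d j))
    (B : ℕ → ℕ → Finset (Fin k →₀ ℕ))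
    (hB : ∀ p D, ∀ m : Fin k →₀ ℕ, m.degree = D → (monomial m 1 : MvPolynomial (Fin k) K) ∈
      Submodule.span K ((fun m => monomial m 1) '' (B p D : Set (Fin k →₀ ℕ))) ⊔
        productSpan G d p D) (p D : ℕ) :
    productSpan G d p D ≤ Submodule.span K {f | ∃ (j : Fin N) (m : Fin k →₀ ℕ),
      d j ≤ D ∧ m ∈ B j (D - d j) ∧ f = G j * monomial m 1} := by
  induction p with
  | zero => exact Submodule.span_le.mpr fun f ⟨j, m, hj, _⟩ => absurd hj (by simp)
  | succ p ih =>
    refine Submodule.span_le.mpr ?_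
    rintro _ ⟨j, m, hj, hm, rfl⟩
    rcases Nat.lt_succ_iff_lt_or_eq.mp hj with hj | rfl
    · exact ih (Submodule.subset_span ⟨j, m, hj, hm, rfl⟩)
    · obtain ⟨u, hu, v, hv, huv⟩ := Submodule.mem_sup.mp (hB j m.degree m rfl)
      rw [SetLike.mem_coe, ← huv, mul_add]
      refine add_mem ?_ (ih (form_mul_mem_productSpan hG hv hm))
      have h := Submodule.mem_map_of_mem (f := LinearMap.mulLeft K (G j)) hu
      rw [Submodule.map_span] at h
      refine Submodule.span_mono ?_ h
      rintro _ ⟨_, ⟨m', hm', rfl⟩, rfl⟩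
      refine ⟨j, m', by omega, ?_, rfl⟩
      rwa [show D - d j = m.degree by omega]

theorem finrank_span_products_le (B : ℕ → ℕ → Finset (Fin k →₀ ℕ)) (D : ℕ) :
    Module.Finite K (Submodule.span K {f | ∃ (j : Fin N) (m : Fin k →₀ ℕ),
      d j ≤ D ∧ m ∈ B j (D - d j) ∧ f = G j * monomial m 1}) ∧
    Module.finrank K (Submodule.span K {f | ∃ (j : Fin N) (m : Fin k →₀ ℕ),
      d j ≤ D ∧ m ∈ B j (D - d j) ∧ f = G j * monomial m 1}) ≤
      ∑ j : Fin N, (if d j ≤ D then B j (D - d j) else ∅).card := by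
  classical
  let T : Finset (MvPolynomial (Fin k) K) := Finset.univ.biUnion fun j : Fin N =>
    (if d j ≤ D then B j (D - d j) else ∅).image fun m => G j * monomial m 1
  have hT : {f | ∃ (j : Fin N) (m : Fin k →₀ ℕ),
      d j ≤ D ∧ m ∈ B j (D - d j) ∧ f = G j * monomial m 1} = (T : Set _) := by
    ext f
    simp only [Set.mem_ofPred_eq, T, Finset.coe_biUnion, Set.mem_iUnion, Finset.mem_coe,
      Finset.mem_image, Finset.mem_univ, exists_prop, true_and]
    refine exists_congr fun j => exists_congr fun m => ?_
    split_ifs with h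
    · simp [h, eq_comm]
    · simp [h]
  rw [hT]
  refine ⟨inferInstance, (finrank_span_finset_le_card T).trans
    (Finset.card_biUnion_le.trans (Finset.sum_le_sum fun j _ => Finset.card_image_le))⟩

theorem homogeneousSubmodule_eq_span_range (e : Fin k → ℕ) (D : ℕ) :
    homogeneousSubmodule (Fin k) K D = Submodule.span K
      (Set.range fun m : boxExponents e 0 D => monomial m.1 (1 : K)) := by
  refine le_antisymm (fun f hf => Submodule.span_mono ?_ hf.mem_span_monomial)
    (Submodule.span_le.mpr ?_)
  · rintro _ ⟨m, hm, rfl⟩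
    exact ⟨⟨m, mem_boxExponents.mpr ⟨hm, by simp⟩⟩, rfl⟩
  · rintro _ ⟨m, rfl⟩
    exact isHomogeneous_monomial 1 (mem_boxExponents.mp m.2).1

theorem linearIndependent_monomial_subtype (s : Finset (Fin k →₀ ℕ)) :
    LinearIndependent K fun m : s => monomial m.1 (1 : K) := by
  have h := (basisMonomials (Fin k) K).linearIndependent.comp (Subtype.val : s → _)
    Subtype.val_injective
  simpa [Function.comp_def] using h

theorem finrank_homogeneousSubmodule (e : Fin k → ℕ) (D : ℕ) :
    Module.finrank K (homogeneousSubmodule (Fin k) K D) = (boxExponents e 0 D).card := by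
  rw [homogeneousSubmodule_eq_span_range e, finrank_span_eq_card
    (linearIndependent_monomial_subtype _), Fintype.card_coe]

end Forms

section Deformation

open MvPolynomial

variable {K : Type*} [Field K] {k N : ℕ} {d : Fin N → ℕ}

theorem productSpan_le_homogeneousSubmodule {G : Fin N → MvPolynomial (Fin k) K}
    (hG : ∀ j, (G j).IsHomogeneous (d j)) (p D : ℕ) :
    productSpan G d p D ≤ homogeneousSubmodule (Fin k) K D := by
  refine Submodule.span_le.mpr ?_
  rintro _ ⟨j, m, _, hm, rfl⟩
  rw [← hm, add_comm]
  exact (hG j).mul (isHomogeneous_monomial 1 rfl)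

/-- If the first `k` forms of a family over `K[X]` specialize to powers of the variables at `1`,
then, over the fraction field, the monomials in the box span the quotient by these forms. -/
theorem monomial_mem_box_sup_productSpan (hk : k ≤ N)
    (G : Fin N → MvPolynomial (Fin k) (Polynomial K)) (hG : ∀ j, (G j).IsHomogeneous (d j))
    (hG1 : ∀ i : Fin k, map (Polynomial.evalRingHom 1) (G (Fin.castLE hk i)) =
      X i ^ d (Fin.castLE hk i)) (p D : ℕ) (m : Fin k →₀ ℕ) (hm : m.degree = D) :
    (monomial m 1 : MvPolynomial (Fin k) (FractionRing (Polynomial K))) ∈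
      Submodule.span (FractionRing (Polynomial K)) ((fun m => monomial m 1) ''
        (boxExponents (fun i => d (Fin.castLE hk i)) p D : Set (Fin k →₀ ℕ))) ⊔
        productSpan (fun j => map (algebraMap _ (FractionRing (Polynomial K))) (G j)) d p D := by
  set L := FractionRing (Polynomial K)
  set e := fun i => d (Fin.castLE hk i) with he
  set W := Submodule.span L ((fun m => (monomial m 1 : MvPolynomial (Fin k) L)) ''
        (boxExponents e p D : Set (Fin k →₀ ℕ))) ⊔
        productSpan (fun j => map (algebraMap _ L) (G j)) d p D with hW
  have hw : ∀ m : boxExponents e 0 D, ∃ w : MvPolynomial (Fin k) (Polynomial K),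
      map (Polynomial.evalRingHom 1) w = monomial m.1 1 ∧ map (algebraMap _ L) w ∈ W := by
    rintro ⟨m, hm⟩
    replace hm := (mem_boxExponents.mp hm).1
    by_cases hmp : m ∈ boxExponents e p D
    · refine ⟨monomial m 1, by simp, ?_⟩
      exact Submodule.mem_sup_left (Submodule.subset_span ⟨m, hmp, by simp⟩)
    · obtain ⟨i, hip, hi⟩ : ∃ i : Fin k, i.val < p ∧ e i ≤ m i := by
        by_contra! h
        exact hmp (mem_boxExponents.mpr ⟨hm, h⟩)
      have hle : Finsupp.single i (e i) + (m - Finsupp.single i (e i)) = m :=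
        add_tsub_cancel_of_le (Finsupp.single_le_iff.mpr hi)
      refine ⟨G (Fin.castLE hk i) * monomial (m - Finsupp.single i (e i)) 1, ?_, ?_⟩
      · rw [map_mul, hG1, map_monomial, map_one, X_pow_eq_monomial, monomial_mul, one_mul]
        exact congrArg (fun m => monomial m (1 : K)) hle
      · refine Submodule.mem_sup_right (Submodule.subset_span
          ⟨Fin.castLE hk i, m - Finsupp.single i (e i), hip, ?_, by simp⟩)
        rw [← hm]
        conv_rhs => rw [← hle]
        rw [map_add, Finsupp.degree_single, add_comm]
  choose w hw1 hwW using hw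
  have hli : LinearIndependent L fun m => map (algebraMap (Polynomial K) L) (w m) := by
    refine linearIndependent_map_fractionRing 1 w ?_
    simp only [hw1]
    exact linearIndependent_monomial_subtype _
  have hWD : W ≤ homogeneousSubmodule (Fin k) L D := by
    refine sup_le (Submodule.span_le.mpr ?_)
      (productSpan_le_homogeneousSubmodule (fun j => (hG j).map _) p D)
    rintro _ ⟨m, hm, rfl⟩
    exact isHomogeneous_monomial 1 (mem_boxExponents.mp hm).1
  have hsW : Submodule.span L (Set.range fun m => map (algebraMap (Polynomial K) L) (w m)) ≤ W :=
    Submodule.span_le.mpr (by rintro _ ⟨m, rfl⟩; exact hwW m)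
  have hfin : Module.Finite L (homogeneousSubmodule (Fin k) L D) :=
    Module.Finite.iff_fg.mpr (homogeneousSubmodule_fg _ _ _)
  have heq := Submodule.eq_of_le_of_finrank_eq (hsW.trans hWD) (by
    rw [finrank_span_eq_card hli, finrank_homogeneousSubmodule e, Fintype.card_coe])
  exact hsW (heq ▸ isHomogeneous_monomial 1 hm)

/-- The dimension of the degree `D` part of an ideal generated by forms is at most that of the
monomial ideal obtained by replacing the first `k` forms by powers of the variables, and adding
independent multiples of the other forms. -/
theorem finrank_productSpan_le (hk : k ≤ N) (F : Fin N → MvPolynomial (Fin k) K)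
    (hF : ∀ j, (F j).IsHomogeneous (d j)) (D : ℕ) :
    Module.finrank K (productSpan F d N D) ≤ ∑ j : Fin N, (if d j ≤ D then
      boxExponents (fun i => d (Fin.castLE hk i)) j (D - d j) else ∅).card := by
  let M : Fin N → MvPolynomial (Fin k) K := fun j =>
    if h : j.val < k then X ⟨j, h⟩ ^ d j else 0
  have hM : ∀ j, (M j).IsHomogeneous (d j) := by
    intro j
    simp only [M]
    split_ifs with h
    · simpa using (isHomogeneous_X K (⟨j, h⟩ : Fin k)).pow (d j)
    · exact isHomogeneous_zero _ _ _
  let G : Fin N → MvPolynomial (Fin k) (Polynomial K) := fun j =>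
    C (1 - Polynomial.X) * map Polynomial.C (F j) + C Polynomial.X * map Polynomial.C (M j)
  have hG : ∀ j, (G j).IsHomogeneous (d j) := fun j =>
    (((hF j).map _).C_mul _).add (((hM j).map _).C_mul _)
  have hev : ∀ (a : K) (f : MvPolynomial (Fin k) K),
      map (Polynomial.evalRingHom a) (map Polynomial.C f) = f := by
    intro a f
    rw [map_map, show (Polynomial.evalRingHom a).comp Polynomial.C = RingHom.id K by ext; simp,
      map_id]
  have hG0 : ∀ j, map (Polynomial.evalRingHom 0) (G j) = F j := by
    intro j
    simp [G, hev]
  have hG1 : ∀ i : Fin k, map (Polynomial.evalRingHom 1) (G (Fin.castLE hk i)) =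
      X i ^ d (Fin.castLE hk i) := by
    intro i
    simp [G, hev, M]
  let L := FractionRing (Polynomial K)
  have hle := productSpan_le_span (G := fun j => map (algebraMap _ L) (G j))
    (fun j => (hG j).map _) _ (monomial_mem_box_sup_productSpan hk G hG hG1) N D
  obtain ⟨hfin, hcard⟩ := finrank_span_products_le (G := fun j => map (algebraMap _ L) (G j))
    (d := d) (boxExponents (fun i => d (Fin.castLE hk i))) D
  refine le_trans ?_ hcard
  obtain ⟨s, hs, hspan, hli⟩ := exists_linearIndependent K {f | ∃ (j : Fin N) (m : Fin k →₀ ℕ),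
    j.val < N ∧ m.degree + d j = D ∧ f = F j * monomial m 1}
  have hlift : ∀ f : s, ∃ g : MvPolynomial (Fin k) (Polynomial K),
      map (Polynomial.evalRingHom 0) g = f.1 ∧
        map (algebraMap _ L) g ∈ productSpan (fun j => map (algebraMap _ L) (G j)) d N D := by
    rintro ⟨f, hf⟩
    obtain ⟨j, m, hj, hm, rfl⟩ := hs hf
    exact ⟨G j * monomial m 1, by simp [hG0], Submodule.subset_span ⟨j, m, hj, hm, by simp⟩⟩
  choose g hg hgL using hlift
  have hliL : LinearIndependent L fun f => map (algebraMap (Polynomial K) L) (g f) := by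
    refine linearIndependent_map_fractionRing 0 g ?_
    simpa only [hg] using hli
  have hliW := LinearIndependent.of_comp (Submodule.subtype _) (v := fun f : s =>
    (⟨_, hle (hgL f)⟩ : Submodule.span L {f | ∃ (j : Fin N) (m : Fin k →₀ ℕ), d j ≤ D ∧
      m ∈ boxExponents (fun i => d (Fin.castLE hk i)) j (D - d j) ∧
        f = map (algebraMap _ L) (G j) * monomial m 1})) hliL
  have : Finite s := hliW.finite
  have := Fintype.ofFinite s
  rw [productSpan, ← hspan]
  have h1 := finrank_span_eq_card hli
  rw [Subtype.range_coe] at h1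
  exact h1.trans_le hliW.fintype_card_le_finrank

/-- Lower bound for the Hilbert function of the quotient by an ideal generated by forms. -/
theorem card_boxExponents_le_hilbertFunction (hk : k ≤ N) (F : Fin N → MvPolynomial (Fin k) K)
    (hF : ∀ j, (F j).IsHomogeneous (d j)) (D : ℕ) :
    (boxExponents (fun i => d (Fin.castLE hk i)) 0 D).card ≤
      hilbertFunction K (quotientPiece (Ideal.span (Set.range F))) D +
        ∑ j : Fin N, (if d j ≤ D then
          boxExponents (fun i => d (Fin.castLE hk i)) j (D - d j) else ∅).card := by
  set I := Ideal.span (Set.range F)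
  have hfin : Module.Finite K (homogeneousSubmodule (Fin k) K D) :=
    Module.Finite.iff_fg.mpr (homogeneousSubmodule_fg _ _ _)
  let q := (Ideal.Quotient.mkₐ K I).toLinearMap.domRestrict (homogeneousSubmodule (Fin k) K D)
  have hq := q.finrank_range_add_finrank_ker
  rw [finrank_homogeneousSubmodule (fun i => d (Fin.castLE hk i)), LinearMap.range_domRestrict]
    at hq
  rw [← hq]
  refine Nat.add_le_add_left (le_trans ?_ (finrank_productSpan_le hk F hF D)) _
  have hfin' : Module.Finite K (productSpan F d N D) :=
    Submodule.finiteDimensional_of_le (productSpan_le_homogeneousSubmodule hF N D)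
  rw [(Submodule.equivSubtypeMap _ (LinearMap.ker q)).finrank_eq]
  refine Submodule.finrank_mono ?_
  rintro _ ⟨f, hf, rfl⟩
  exact mem_productSpan_of_mem_span hF f.2 (Ideal.Quotient.eq_zero_iff_mem.mp hf)

end Deformation

section HilbertSeries

open PowerSeries

@[to_additive]
theorem prod_filter_castLE {M : Type*} [CommMonoid M] {k N : ℕ} (hk : k ≤ N) (f : Fin N → M) :
    ∏ j : Fin N with j.val < k, f j = ∏ i : Fin k, f (Fin.castLE hk i) := by
  refine Eq.trans (Finset.prod_congr ?_ fun _ _ => rfl)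
    (Finset.prod_map Finset.univ (Fin.castLEEmb hk) f)
  ext j
  simp only [Finset.mem_filter, Finset.mem_univ, true_and, Finset.mem_map, Fin.castLEEmb_apply]
  exact ⟨fun h => ⟨⟨j, h⟩, rfl⟩, by rintro ⟨i, rfl⟩; exact i.2⟩

theorem sum_X_pow_mul_boxSeries_castLE {k N : ℕ} (hk : k ≤ N) (d : Fin N → ℕ) :
    ∑ j : Fin N, X ^ d j * boxSeries (fun i => d (Fin.castLE hk i)) j =
      boxSeries (fun i => d (Fin.castLE hk i)) 0 -
        (1 - ∑ j : Fin N with k ≤ j.val, X ^ d j) *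
          boxSeries (fun i => d (Fin.castLE hk i)) k := by
  rw [← Finset.sum_filter_add_sum_filter_not Finset.univ (fun j : Fin N => j.val < k)]
  rw [sum_filter_castLE hk]
  simp only [Fin.val_castLE]
  rw [sum_X_pow_mul_boxSeries (fun i => d (Fin.castLE hk i)), sub_mul, one_mul,
    Finset.sum_mul]
  simp only [not_lt]
  rw [Finset.sum_congr rfl fun j hj => ?_]
  · ring
  · congr 1
    ext D
    simp only [boxSeries, coeff_mk]
    rw [boxExponents_of_le _ (Finset.mem_filter.mp hj).2]

theorem card_filter_le_val (k N : ℕ) :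
    (Finset.univ.filter fun j : Fin N => k ≤ j.val).card = N - k := by
  have h := Finset.card_filter_add_card_filter_not (s := (Finset.univ : Finset (Fin N)))
    (fun j => j.val < k)
  simp only [not_lt, Fin.card_filter_val_lt, Finset.card_univ, Fintype.card_fin] at h
  omega

end HilbertSeries

theorem mainTheorem4 {K : Type*} [Field K] (n c : ℕ) (hc : 1 ≤ c)
    (d : Fin (n + c) → ℕ) (F : Fin (n + c) → MvPolynomial (Fin (n + 1)) K)
    (hF : ∀ j, (F j).IsHomogeneous (d j)) :
    (∀ D : ℕ,
      PowerSeries.coeff D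
          ((1 - ∑ j : Fin (n + c) with n + 1 ≤ j.val, (PowerSeries.X : PowerSeries ℤ) ^ d j)
            * (∏ j : Fin (n + c) with j.val < n + 1, (1 - (PowerSeries.X : PowerSeries ℤ) ^ d j))
            * (PowerSeries.invOneSubPow ℤ (n + 1) : PowerSeries ℤ))
        ≤ PowerSeries.coeff D
            (hilbertSeries K (quotientPiece (Ideal.span (Set.range F)))))
    ∧ ∀ e : ℕ, (∀ j, d j = e) →
        ((1 - ∑ j : Fin (n + c) with n + 1 ≤ j.val, (PowerSeries.X : PowerSeries ℤ) ^ d j)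
            * (∏ j : Fin (n + c) with j.val < n + 1, (1 - (PowerSeries.X : PowerSeries ℤ) ^ d j))
            * (PowerSeries.invOneSubPow ℤ (n + 1) : PowerSeries ℤ)
          = (1 - ((c : PowerSeries ℤ) - 1) * PowerSeries.X ^ e)
              * (∑ i ∈ Finset.range e, PowerSeries.X ^ i) ^ (n + 1))
        ∧ ∀ D : ℕ,
          PowerSeries.coeff D
              ((1 - ((c : PowerSeries ℤ) - 1) * PowerSeries.X ^ e)
                * (∑ i ∈ Finset.range e, PowerSeries.X ^ i) ^ (n + 1))
            ≤ PowerSeries.coeff D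
                (hilbertSeries K (quotientPiece (Ideal.span (Set.range F)))) := by
  have hk : n + 1 ≤ n + c := by omega
  have bound : ∀ D : ℕ,
      PowerSeries.coeff D
          ((1 - ∑ j : Fin (n + c) with n + 1 ≤ j.val, (PowerSeries.X : PowerSeries ℤ) ^ d j)
            * (∏ j : Fin (n + c) with j.val < n + 1, (1 - (PowerSeries.X : PowerSeries ℤ) ^ d j))
            * (PowerSeries.invOneSubPow ℤ (n + 1) : PowerSeries ℤ))
        ≤ PowerSeries.coeff D
            (hilbertSeries K (quotientPiece (Ideal.span (Set.range F)))) := by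
    intro D
    have h1 := congrArg (PowerSeries.coeff D) (sum_X_pow_mul_boxSeries_castLE hk d)
    have h2 := card_boxExponents_le_hilbertFunction hk F hF D
    rw [map_sub, map_sum] at h1
    simp only [coeff_X_pow_mul_boxSeries] at h1
    rw [mul_assoc, prod_filter_castLE hk, ← boxSeries_eq fun i => d (Fin.castLE hk i)]
    simp only [hilbertSeries, PowerSeries.coeff_mk]
    have h3 : PowerSeries.coeff D (boxSeries (fun i => d (Fin.castLE hk i)) 0) =
        ((boxExponents (fun i => d (Fin.castLE hk i)) 0 D).card : ℤ) := by
      simp [boxSeries]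
    rw [h3, ← Nat.cast_sum] at h1
    omega
  refine ⟨bound, fun e he => ?_⟩
  have heq : (1 - ∑ j : Fin (n + c) with n + 1 ≤ j.val, (PowerSeries.X : PowerSeries ℤ) ^ d j)
            * (∏ j : Fin (n + c) with j.val < n + 1, (1 - (PowerSeries.X : PowerSeries ℤ) ^ d j))
            * (PowerSeries.invOneSubPow ℤ (n + 1) : PowerSeries ℤ)
          = (1 - ((c : PowerSeries ℤ) - 1) * PowerSeries.X ^ e)
              * (∑ i ∈ Finset.range e, PowerSeries.X ^ i) ^ (n + 1) := by
    have hinv : (1 - PowerSeries.X : PowerSeries ℤ) ^ (n + 1) *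
        (PowerSeries.invOneSubPow ℤ (n + 1) : PowerSeries ℤ) = 1 := by
      rw [← PowerSeries.invOneSubPow_inv_eq_one_sub_pow]
      exact (PowerSeries.invOneSubPow ℤ (n + 1)).inv_val
    rw [prod_filter_castLE hk]
    simp only [he, Finset.sum_const, Finset.prod_const, card_filter_le_val, Finset.card_univ,
      Fintype.card_fin, nsmul_eq_mul]
    rw [show n + c - (n + 1) = c - 1 by omega, Nat.cast_sub hc, Nat.cast_one, mul_assoc,
      ← geom_sum_mul_neg, mul_pow, mul_assoc, hinv, mul_one]
  exact ⟨heq, fun D => heq ▸ bound D⟩
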